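/- Consider the $(n,L)$-regular tree: a master and $L\ge 1$ layers of workers, in which the master and every worker not in the last layer has exactly $n$ children (so $N=n+\cdots+n^L$ workers). Let $0<s<n$ and $\alpha=s/n$. CodedReduce (CR) gives each worker $r_{\mathsf{CR}}\,d$ of the $d$ data points, where $$r_{\mathsf{CR}}=\Big(\sum_{l=1}^{L}\big(\tfrac{n}{s+1}\big)^{l}\Big)^{-1}.$$ All workers start computing at time $0$; their computation times are independent, with $$\mathbb P[T_w\le t]=1-e^{-\frac{\mu}{r_{\mathsf{CR}}d}(t-a\,r_{\mathsf{CR}}d)}\qquad\text{for } t\ge a\,r_{\mathsf{CR}}d ,$$ where $\mu>0$ and $a\ge 0$ are constants. A leaf has its message available once its computation is done; any other worker has its message available once its own computation is done and it has received messages from $n-s$ of its children. A parent receives from only one child at a time, each transmission takes a constant time $t_c\ge 0$, and a parent starts the next reception (in order of availability) as soon as it is free and a message is available. The run-time $T_{\mathsf{CR}}$ is the time at which the master has received messages from $n-s$ of its children. Let $n\to\infty$ with $L,d,a,\mu,t_c$ and $\alpha=s/n\in(0,1)$ fixed. Then $T_{\mathsf{CR}}$ is integrable and $$\mathbb E[T_{\mathsf{CR}}]\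 \ge\ \frac{r_{\mathsf{CR}}d}{\mu}\log\frac1\alpha+a\,r_{\mathsf{CR}}d+\big(n(1-\alpha)-o(n)+L-1\big)\big(1-o(1)\big)t_c+o(1),$$ $$\mathbb E[T_{\mathsf{CR}}]\ \le\ \frac{r_{\mathsf{CR}}d}{\mu}\log\frac1\alpha+a\,r_{\mathsf{CR}}d+n\big(1-o(1)\big)L\,t_c+o(1),$$ where the subtracted $o(\cdot)$ terms are nonnegative. In particular, if $t_c>0$, $\mathbb E[T_{\mathsf{CR}}]=\Theta(1)+\Theta(n)$: the computation part $\frac{r_{\mathsf{CR}}d}{\mu}\log\frac1\alpha+a\,r_{\mathsf{CR}}d$ is $\Theta(1)$ and the rest of $\mathbb E[T_{\mathsf{CR}}]$ is $\Theta(n)$. -/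

import Mathlib

open MeasureTheory ProbabilityTheory Filter Asymptotics
open scoped Topology

namespace CodedReduce

/-- The workers located below a parent that has `h` layers of workers underneath it, every parent
having `n` children. `Worker n L` is the set of all workers of the `(n, L)`-regular tree (the
vertices other than the master). `child i` is the `i`-th child of the parent; `inside i w` is the
worker `w` of the subtree hanging under that child. -/
inductive Worker (n : ℕ) : ℕ → Type
  | child {h : ℕ} (i : Fin n) : Worker n (h + 1)
  | inside {h : ℕ} (i : Fin n) (w : Worker n h) : Worker n (h + 1)

/-- The computation load of CodedReduce: the fraction of the data set given to each worker,
`1 / ((n/(s+1)) + ⋯ + (n/(s+1))^L)`. -/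
noncomputable def load (n s L : ℕ) : ℝ :=
  1 / ∑ l ∈ Finset.Icc 1 L, ((n : ℝ) / ((s : ℝ) + 1)) ^ l

/-- The time at which a parent has received `m` messages, when child `i` has its message available
at time `ready i`, each transmission takes `tc`, and the parent receives from one child at a time,
in order of availability: the next reception starts as soon as the parent is free and the
message is available. -/
noncomputable def receiveTime (tc : ℝ) {n : ℕ} (m : ℕ) (ready : Fin n → ℝ) : ℝ :=
  ((List.ofFn (ready ∘ Tuple.sort ready)).take m).foldl (fun c r => max c r + tc) 0

/-- Given the local computation times `t` of the workers below a parent with `h` layers underneath,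
the time at which this parent has received enough (`n - s`) of its children's messages.
All local computations start at time `0`. A child's message is available once the child has both
finished its own local computation and received enough messages from its own children. A node
without children (`h = 0`) waits for nobody. -/
noncomputable def recoverTime (n s : ℕ) (tc : ℝ) : (h : ℕ) → (Worker n h → ℝ) → ℝ
  | 0, _ => 0
  | h + 1, t => receiveTime tc (n - s) fun i =>
      max (t (Worker.child i)) (recoverTime n s tc h fun w => t (Worker.inside i w))

/-- The run-time of CodedReduce on the `(n, L)`-regular tree: the time at which the master has
received enough messages from its children. -/
noncomputable def runTime (n s L : ℕ) (tc : ℝ) (t : Worker n L → ℝ) : ℝ :=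
  recoverTime n s tc L t

/-- `X` is the random computation time of a worker holding `di` data points: a shifted exponential
random variable with shift `a * di` and rate `μ / di`. -/
def IsComputationTime {Ω : Type*} [MeasurableSpace Ω] (P : Measure Ω) (a μ di : ℝ)
    (X : Ω → ℝ) : Prop :=
  Measurable X ∧
    ∀ t : ℝ, a * di ≤ t → P.real {ω | X ω ≤ t} = 1 - Real.exp (-(μ / di) * (t - a * di))

/-- The computation part of the bounds, `(r d / μ) log (1/α) + a r d`, with `r` the load. -/
noncomputable def compTerm (n s L : ℕ) (d a μ α : ℝ) : ℝ :=
  load n s L * d / μ * Real.log (1 / α) + a * load n s L * d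

end CodedReduce

/-!
The computation term `q` is the `(1 - α)`-quantile of the computation time of a single worker: at
time `q` a worker is still computing with probability `α`. So among `n` siblings it is about `n - s`
that have finished at time `q`, and by Hoeffding's inequality (`measureReal_le_card_le_exp`) the
probability that fewer than `n - s` have finished at `q + ε`, or at least `n - s` at `q - ε`, is
exponentially small in `n`.

Upper bound. If at a time `x` at least `n - s` workers in every family of siblings have finished,
then each of the `L` levels adds at most `n - s` transmissions, and the run-time is at most
`x + L (n - s) tc` (`recoverTime_succ_le`). The tree has polynomially many families, so a union bound
(`measureReal_lt_recoverTime_le`) suffices; no information on the joint law of the recovery times of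
different subtrees is needed. To integrate the tail, the Hoeffding bound is interpolated with the
exponential tail of a single computation time (`measureReal_card_lt_le`). This gives
`E ≤ q + L n (1 - α) tc + o(1)`, and integrability.

Lower bound. For `tc = 0`, the master cannot finish before `n - s` of its children have finished
computing, which gives `E ≥ q - o(1)` (`quantile_sub_mul_le_integral_runTime`). For `tc > 0`, on
every outcome `n - s` receptions take place in succession on each of the `L` levels, so that the
run-time is at least `L (n - s) tc` (`mul_le_recoverTime`), and the bounded computation term is
absorbed by the allowed loss `o(n) tc`.
-/

namespace CodedReduce

/-! ### Pathwise estimates for the reception schedule -/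

lemma foldl_max_add_le {tc y : ℝ} (htc : 0 ≤ tc) (l : List ℝ) (hl : ∀ r ∈ l, r ≤ y) :
    ∀ c ≤ y, l.foldl (fun c r => max c r + tc) c ≤ y + l.length * tc := by
  -- After each step the bound `y` moves up by `tc`, which keeps dominating the later entries.
  induction l generalizing y with
  | nil => intro c hc; simpa using hc
  | cons r l ih =>
    intro c hc
    have hr : r ≤ y := hl r (by simp)
    have := ih (y := y + tc) (fun r' hr' => (hl r' (by simp [hr'])).trans (by linarith))
      (max c r + tc) (by gcongr; exact max_le hc hr)
    simp only [List.foldl_cons, List.length_cons]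
    push_cast
    linarith

lemma le_foldl_max_add {tc : ℝ} (htc : 0 ≤ tc) (l : List ℝ) (c : ℝ) :
    c ≤ l.foldl (fun c r => max c r + tc) c ∧
      ∀ r ∈ l, r ≤ l.foldl (fun c r => max c r + tc) c := by
  induction l generalizing c with
  | nil => simp
  | cons r l ih =>
    obtain ⟨h1, h2⟩ := ih (max c r + tc)
    simp only [List.foldl_cons, List.mem_cons, forall_eq_or_imp]
    exact ⟨by linarith [le_max_left c r], by linarith [le_max_right c r], h2⟩

lemma add_length_mul_le_foldl {tc b : ℝ} (l : List ℝ) :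
    ∀ c, b ≤ c → b + l.length * tc ≤ l.foldl (fun c r => max c r + tc) c := by
  induction l generalizing b with
  | nil => intro c hc; simpa using hc
  | cons r l ih =>
    intro c hc
    have := ih (b := b + tc) (max c r + tc) (by gcongr; exact hc.trans (le_max_left _ _))
    simp only [List.foldl_cons, List.length_cons]
    push_cast
    linarith

variable {n : ℕ}

lemma card_filter_comp_perm (σ : Equiv.Perm (Fin n)) (p : Fin n → Prop) [DecidablePred p] :
    (Finset.univ.filter fun i => p (σ i)).card = (Finset.univ.filter p).card :=
  Finset.card_bij (fun i _ => σ i) (by simp) (by simp) (fun b hb => ⟨σ.symm b, by simpa using hb⟩)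

lemma mem_take_sort_iff {ready : Fin n → ℝ} {m : ℕ} {r : ℝ} :
    r ∈ (List.ofFn (ready ∘ Tuple.sort ready)).take m ↔
      ∃ j : Fin n, (j : ℕ) < m ∧ ready (Tuple.sort ready j) = r := by
  rw [List.mem_take_iff_getElem]
  constructor
  · rintro ⟨i, hi, rfl⟩
    simp only [List.length_ofFn, lt_min_iff] at hi
    exact ⟨⟨i, hi.2⟩, hi.1, by simp⟩
  · rintro ⟨j, hj, rfl⟩
    exact ⟨j, by simp [hj], by simp⟩

/-- The `j`-th order statistic is at most `y` iff more than `j` entries are at most `y`. -/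
lemma ready_sort_le_iff {ready : Fin n → ℝ} {j : Fin n} {y : ℝ} :
    ready (Tuple.sort ready j) ≤ y ↔ (j : ℕ) < (Finset.univ.filter fun i => ready i ≤ y).card := by
  have h := Tuple.lt_card_le_iff_apply_le_of_monotone (j := j) (a := y)
    (Tuple.monotone_sort ready)
  simp only [Function.comp_apply] at h
  rw [← h, card_filter_comp_perm (Tuple.sort ready) (fun i => ready i ≤ y)]

lemma receiveTime_le {tc y : ℝ} (htc : 0 ≤ tc) (hy : 0 ≤ y) {m : ℕ} {ready : Fin n → ℝ}
    (hm : m ≤ (Finset.univ.filter fun i => ready i ≤ y).card) :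
    receiveTime tc m ready ≤ y + m * tc := by
  refine (foldl_max_add_le htc _ (fun r hr => ?_) 0 hy).trans ?_
  · obtain ⟨j, hj, rfl⟩ := mem_take_sort_iff.1 hr
    exact ready_sort_le_iff.2 (hj.trans_le hm)
  · gcongr
    simp

lemma receiveTime_nonneg {tc : ℝ} (htc : 0 ≤ tc) (m : ℕ) (ready : Fin n → ℝ) :
    0 ≤ receiveTime tc m ready :=
  (le_foldl_max_add htc _ 0).1

lemma le_card_of_receiveTime_le {tc y : ℝ} (htc : 0 ≤ tc) {m : ℕ} (hmn : m ≤ n)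
    {ready : Fin n → ℝ} (h : receiveTime tc m ready ≤ y) :
    m ≤ (Finset.univ.filter fun i => ready i ≤ y).card := by
  rcases Nat.eq_zero_or_pos m with rfl | hm
  · simp
  have hj : ready (Tuple.sort ready ⟨m - 1, by omega⟩) ≤ y :=
    ((le_foldl_max_add htc _ 0).2 _ (mem_take_sort_iff.2 ⟨⟨m - 1, by omega⟩, by simp; omega, rfl⟩)).trans
      h
  have := ready_sort_le_iff.1 hj
  simp only at this
  omega

lemma add_mul_le_receiveTime {tc b : ℝ} {m : ℕ} (hm : 0 < m) (hmn : m ≤ n)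
    {ready : Fin n → ℝ} (hb : ∀ i, b ≤ ready i) :
    b + m * tc ≤ receiveTime tc m ready := by
  -- The first reception already starts no earlier than `b`.
  have hmem : ∀ r ∈ (List.ofFn (ready ∘ Tuple.sort ready)).take m, b ≤ r := by
    intro r hr
    obtain ⟨j, -, rfl⟩ := mem_take_sort_iff.1 hr
    exact hb _
  have hlen : ((List.ofFn (ready ∘ Tuple.sort ready)).take m).length = m := by simp [hmn]
  unfold receiveTime
  generalize (List.ofFn (ready ∘ Tuple.sort ready)).take m = l at hmem hlen
  subst hlen
  cases l with
  | nil => simp at hm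
  | cons r l =>
    have := add_length_mul_le_foldl (tc := tc) (b := b + tc) l (max 0 r + tc)
      (by gcongr; exact (hmem r (by simp)).trans (le_max_right _ _))
    simp only [List.foldl_cons, List.length_cons]
    push_cast
    linarith

/-! ### Pathwise estimates for the recovery time -/

lemma recoverTime_nonneg {s : ℕ} {tc : ℝ} (htc : 0 ≤ tc) :
    ∀ {h : ℕ} (t : Worker n h → ℝ), 0 ≤ recoverTime n s tc h t
  | 0, _ => le_rfl
  | _ + 1, _ => receiveTime_nonneg htc _ _

/-- Every branch of the tree costs at least `n - s` successive receptions at each of its parents. -/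
lemma mul_le_recoverTime {s : ℕ} (hs : s < n) {tc : ℝ} :
    ∀ {h : ℕ} (t : Worker n h → ℝ), h * ((n - s : ℕ) * tc) ≤ recoverTime n s tc h t
  | 0, _ => by simp [recoverTime]
  | h + 1, t => by
    have := add_mul_le_receiveTime (tc := tc) (b := h * ((n - s : ℕ) * tc))
      (m := n - s) (by omega) (by omega) (ready := fun i =>
        max (t (Worker.child i)) (recoverTime n s tc h fun w => t (Worker.inside i w)))
      (fun i => (mul_le_recoverTime hs _).trans (le_max_right _ _))
    rw [recoverTime]
    push_cast
    linarith

/-- The master cannot finish by time `y` unless `n - s` of its own children have finished their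
local computation by then. -/
lemma le_card_of_recoverTime_le {s : ℕ} {tc y : ℝ} (htc : 0 ≤ tc) {h : ℕ}
    (t : Worker n (h + 1) → ℝ) (hy : recoverTime n s tc (h + 1) t ≤ y) :
    n - s ≤ (Finset.univ.filter fun i => t (Worker.child i) ≤ y).card := by
  refine (le_card_of_receiveTime_le htc (Nat.sub_le _ _) hy).trans (Finset.card_le_card ?_)
  intro i hi
  simp only [Finset.mem_filter, Finset.mem_univ, true_and] at hi ⊢
  exact (le_max_left _ _).trans hi

/-- One step of the union bound: a late recovery is caused either by the local computations of the
children or by a late recovery at one of the children. -/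
lemma recoverTime_succ_le {s : ℕ} {tc x : ℝ} (htc : 0 ≤ tc) (hx : 0 ≤ x) {h : ℕ}
    (t : Worker n (h + 1) → ℝ)
    (h1 : n - s ≤ (Finset.univ.filter fun i => t (Worker.child i) ≤ x).card)
    (h2 : ∀ i, recoverTime n s tc h (fun w => t (Worker.inside i w)) ≤
      x + h * ((n - s : ℕ) * tc)) :
    recoverTime n s tc (h + 1) t ≤ x + (h + 1 : ℕ) * ((n - s : ℕ) * tc) := by
  have h0 : 0 ≤ (h : ℝ) * ((n - s : ℕ) * tc) := by positivity
  have := receiveTime_le (y := x + h * ((n - s : ℕ) * tc)) htc (by positivity)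
    (m := n - s) (ready := fun i =>
      max (t (Worker.child i)) (recoverTime n s tc h fun w => t (Worker.inside i w)))
    (h1.trans (Finset.card_le_card fun i hi => by
      simp only [Finset.mem_filter, Finset.mem_univ, true_and] at hi ⊢
      exact max_le (by linarith) (h2 i)))
  rw [recoverTime]
  push_cast
  linarith

/-! ### Measurability -/

variable {Ω : Type*} [MeasurableSpace Ω]

lemma measurable_foldl_max_add (tc : ℝ) (l : List (Ω → ℝ)) (hl : ∀ f ∈ l, Measurable f) :
    ∀ c : Ω → ℝ, Measurable c →
      Measurable fun ω => (l.map (· ω)).foldl (fun c r => max c r + tc) (c ω) := by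
  induction l with
  | nil => intro c hc; simpa using hc
  | cons f l ih =>
    intro c hc
    simp only [List.map_cons, List.foldl_cons]
    exact ih (fun g hg => hl g (by simp [hg])) (fun ω => max (c ω) (f ω) + tc)
      ((hc.max (hl f (by simp))).add_const _)

lemma measurableSet_sort_eq {ready : Ω → Fin n → ℝ} (hr : ∀ i, Measurable fun ω => ready ω i)
    (σ : Equiv.Perm (Fin n)) : MeasurableSet {ω | σ = Tuple.sort (ready ω)} := by
  simp only [Tuple.eq_sort_iff, Monotone, Function.comp_apply, Set.ofPred_and, Set.ofPred_forall]
  refine MeasurableSet.inter ?_ ?_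
  · exact .iInter fun i => .iInter fun j => .iInter fun _ => measurableSet_le (hr _) (hr _)
  · refine .iInter fun i => .iInter fun j => .iInter fun _ => ?_
    simp only [imp_iff_not_or]
    exact (measurableSet_eq_fun (hr _) (hr _)).compl.union (.const _)

lemma measurable_receiveTime (tc : ℝ) (m : ℕ) {ready : Ω → Fin n → ℝ}
    (hr : ∀ i, Measurable fun ω => ready ω i) :
    Measurable fun ω => receiveTime tc m (ready ω) := by
  classical
  -- Only finitely many orders of availability occur; split the space accordingly.
  have key : (fun ω => receiveTime tc m (ready ω)) = fun ω => ∑ σ : Equiv.Perm (Fin n),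
      {ω | σ = Tuple.sort (ready ω)}.indicator (fun ω =>
        (((List.ofFn fun i ω => ready ω (σ i)).take m).map (· ω)).foldl
          (fun c r => max c r + tc) 0) ω := by
    ext ω
    rw [Finset.sum_eq_single (Tuple.sort (ready ω))]
    · simp [receiveTime, List.map_take, List.map_ofFn, Function.comp_def]
    · intro σ _ hσ
      simp [hσ]
    · simp
  rw [key]
  refine Finset.measurable_sum _ fun σ _ => Measurable.indicator ?_ (measurableSet_sort_eq hr σ)
  refine measurable_foldl_max_add tc _ (fun f hf => ?_) (fun _ => 0) measurable_const
  obtain ⟨i, rfl⟩ := List.mem_ofFn.1 (List.mem_of_mem_take hf)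
  exact hr _

lemma measurable_recoverTime (s : ℕ) (tc : ℝ) {h : ℕ} {t : Worker n h → Ω → ℝ}
    (ht : ∀ w, Measurable (t w)) : Measurable fun ω => recoverTime n s tc h fun w => t w ω := by
  induction h with
  | zero => exact measurable_const
  | succ h ih =>
    exact measurable_receiveTime tc _ fun i => (ht _).max (ih fun w => ht (Worker.inside i w))

variable {P : Measure Ω} [IsProbabilityMeasure P]

/-! ### Concentration among siblings -/

/-- Hoeffding's inequality for the number of independent events, all of probability `p`, that
occur. -/
lemma measureReal_le_card_le_exp {X : Fin n → Ω → ℝ} (hX : ∀ i, Measurable (X i))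
    (hind : iIndepFun X P) {S : Set ℝ} (hS : MeasurableSet S) [DecidablePred (· ∈ S)] {p β : ℝ}
    (hp : ∀ i, P.real {ω | X i ω ∈ S} = p) (hpβ : p ≤ β) :
    P.real {ω | n * β ≤ (Finset.univ.filter fun i => X i ω ∈ S).card} ≤
      Real.exp (-(2 * n * (β - p) ^ 2)) := by
  rcases Nat.eq_zero_or_pos n with rfl | hn
  · simp
  set f : ℝ → ℝ := S.indicator 1 with hf
  have hfm : Measurable f := measurable_one.indicator hS
  have hmean : ∀ i, ∫ ω, f (X i ω) ∂P = p := by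
    intro i
    have : (fun ω => f (X i ω)) = {ω | X i ω ∈ S}.indicator 1 := by
      ext ω; simp [hf, Set.indicator_apply]
    rw [this, integral_indicator_one (show MeasurableSet {ω | X i ω ∈ S} from hX i hS), hp]
  have hsub : ∀ i ∈ Finset.univ, HasSubgaussianMGF (fun ω => f (X i ω) - p) (1 / 4) P := by
    intro i _
    have h := hasSubgaussianMGF_of_mem_Icc (X := fun ω => f (X i ω)) (μ := P) (a := 0) (b := 1)
      (hfm.comp (hX i)).aemeasurable (ae_of_all _ fun ω => by
        by_cases h : X i ω ∈ S <;> simp [hf, h])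
    rw [hmean] at h
    convert h using 1
    norm_num
  have hI : iIndepFun (fun i ω => f (X i ω) - p) P :=
    hind.comp (fun _ x => f x - p) fun _ => hfm.sub_const _
  have := HasSubgaussianMGF.measure_sum_ge_le_of_iIndepFun hI hsub
    (ε := n * (β - p)) (by have := sub_nonneg.2 hpβ; positivity)
  refine le_trans (le_of_eq ?_) (this.trans (le_of_eq ?_))
  · congr 1
    ext ω
    have : (∑ i, f (X i ω)) = (Finset.univ.filter fun i => X i ω ∈ S).card := by
      simp [hf, Set.indicator_apply]
    simp only [Set.mem_ofPred_eq, Finset.sum_sub_distrib, this, Finset.sum_const, Finset.card_univ,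
      Fintype.card_fin, nsmul_eq_mul, mul_sub]
    constructor <;> intro h <;> linarith
  · congr 1
    have : (n : ℝ) ≠ 0 := by positivity
    simp
    field_simp
    ring

lemma IsComputationTime.measureReal_lt {a μ D x : ℝ} {X : Ω → ℝ}
    (hX : IsComputationTime P a μ D X) (hx : a * D ≤ x) :
    P.real {ω | x < X ω} = Real.exp (-(μ / D) * (x - a * D)) := by
  have : {ω | x < X ω} = {ω | X ω ≤ x}ᶜ := by ext; simp
  rw [this, probReal_compl_eq_one_sub (measurableSet_le hX.1 measurable_const), hX.2 x hx]
  ring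

/-- The `(1 - α)`-quantile of the computation time of a worker holding `D` data points. -/
noncomputable def quantile (D a μ α : ℝ) : ℝ := D / μ * Real.log (1 / α) + a * D

lemma exp_quantile {D a μ α : ℝ} (hD : 0 < D) (hμ : 0 < μ) (hα : 0 < α) (y : ℝ) :
    Real.exp (-(μ / D) * (quantile D a μ α + y - a * D)) = α * Real.exp (-(μ / D) * y) := by
  have : -(μ / D) * (quantile D a μ α + y - a * D) = Real.log α + -(μ / D) * y := by
    rw [quantile, one_div, Real.log_inv]
    field_simp
    ring
  rw [this, Real.exp_add, Real.exp_log hα]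

lemma quantile_sub_pos {D a μ α : ℝ} (hD : 0 < D) (hμ : 0 < μ) (hα : 0 < α) (hα1 : α < 1) :
    0 < quantile D a μ α - a * D := by
  have : 0 < Real.log (1 / α) := Real.log_pos (one_lt_one_div hα hα1)
  rw [quantile, add_sub_cancel_right]
  positivity

/-- Among `n` siblings, it is exponentially unlikely that fewer than `n - s` have finished at a time
`y + ε` beyond the quantile. The bound is the geometric mean of Hoeffding's inequality, which gives
smallness in `n`, and of the union bound, which gives integrability in `y`. -/
lemma measureReal_card_lt_le {s : ℕ} {D a μ α : ℝ} (hD : 0 < D) (hμ : 0 < μ)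
    (hα : 0 < α) (hα1 : α < 1) (hs : (s : ℝ) = α * n) {X : Fin n → Ω → ℝ}
    (hX : ∀ i, IsComputationTime P a μ D (X i)) (hind : iIndepFun X P)
    {ε y : ℝ} (hε : 0 < ε) (hy : 0 ≤ y) :
    P.real {ω | (Finset.univ.filter fun i =>
        X i ω ≤ quantile D a μ α + ε + y).card < n - s} ≤
      n * Real.exp (-(n * (α * (1 - Real.exp (-(μ / D) * ε))) ^ 2)) *
        Real.exp (-(μ / D / 2) * y) := by
  have hc : 0 < μ / D := by positivity
  set x := quantile D a μ α + (ε + y) with hx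
  have hq := quantile_sub_pos (a := a) hD hμ hα hα1
  have htail : ∀ i, P.real {ω | X i ω ∈ Set.Ioi x} = α * Real.exp (-(μ / D) * (ε + y)) := by
    intro i
    rw [← exp_quantile (a := a) hD hμ hα, ← (hX i).measureReal_lt (by linarith)]
    rfl
  have hexp : Real.exp (-(μ / D) * (ε + y)) ≤ Real.exp (-(μ / D) * ε) := by
    refine Real.exp_le_exp.2 ?_
    nlinarith
  have hexp1 : Real.exp (-(μ / D) * ε) ≤ 1 := by
    rw [Real.exp_le_one_iff]; nlinarith
  set v := P.real {ω | (Finset.univ.filter fun i =>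
        X i ω ≤ quantile D a μ α + ε + y).card < n - s} with hv
  set G := Real.exp (-(n * (α * (1 - Real.exp (-(μ / D) * ε))) ^ 2)) with hG
  set F := Real.exp (-(μ / D / 2) * y) with hF
  have hpart : ∀ ω, (Finset.univ.filter fun i => X i ω ≤ quantile D a μ α + ε + y).card +
      (Finset.univ.filter fun i => X i ω ∈ Set.Ioi x).card = n := by
    intro ω
    have := Finset.card_filter_add_card_filter_not (s := (Finset.univ : Finset (Fin n)))
      (fun i => X i ω ≤ quantile D a μ α + ε + y)
    simpa [hx, add_assoc] using this
  have h1 : v ≤ G ^ 2 := by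
    have hmono : v ≤ P.real {ω | n * α ≤ (Finset.univ.filter fun i => X i ω ∈ Set.Ioi x).card} := by
      refine measureReal_mono fun ω hω => ?_
      have := hpart ω
      simp only [Set.mem_ofPred_eq] at hω ⊢
      rw [mul_comm, ← hs]
      exact_mod_cast (by omega)
    refine hmono.trans ((measureReal_le_card_le_exp (fun i => (hX i).1) hind measurableSet_Ioi
      htail (by nlinarith)).trans ?_)
    rw [hG, ← Real.exp_nat_mul]
    refine Real.exp_le_exp.2 ?_
    have : (α * (1 - Real.exp (-(μ / D) * ε))) ^ 2 ≤
        (α - α * Real.exp (-(μ / D) * (ε + y))) ^ 2 := by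
      have h0 : 0 ≤ 1 - Real.exp (-(μ / D) * ε) := by linarith
      gcongr
      nlinarith
    have hn : (0 : ℝ) ≤ n := by positivity
    push_cast
    nlinarith
  have h2 : v ≤ n * F ^ 2 := by
    have hmono : v ≤ P.real (⋃ i, {ω | X i ω ∈ Set.Ioi x}) := by
      refine measureReal_mono fun ω hω => ?_
      have := hpart ω
      simp only [Set.mem_ofPred_eq] at hω
      have hpos : 0 < (Finset.univ.filter fun i => X i ω ∈ Set.Ioi x).card := by omega
      obtain ⟨i, hi⟩ := Finset.card_pos.1 hpos
      exact Set.mem_iUnion.2 ⟨i, by simpa using hi⟩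
    refine hmono.trans ((measureReal_iUnion_fintype_le _).trans ?_)
    simp only [htail, Finset.sum_const, Finset.card_univ, Fintype.card_fin, nsmul_eq_mul]
    have : Real.exp (-(μ / D) * (ε + y)) ≤ F ^ 2 := by
      rw [hF, ← Real.exp_nat_mul]
      refine Real.exp_le_exp.2 ?_
      push_cast
      nlinarith
    gcongr
    nlinarith [Real.exp_pos (-(μ / D) * (ε + y))]
  rcases Nat.eq_zero_or_pos n with rfl | hn
  · simpa using h2
  have hn1 : (1 : ℝ) ≤ n := by exact_mod_cast hn
  have hv0 : 0 ≤ v := measureReal_nonneg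
  refine (sq_le_sq₀ hv0 (by positivity)).1 ?_
  calc v ^ 2 = v * v := sq v
    _ ≤ G ^ 2 * (n * F ^ 2) := by gcongr
    _ = n * (G * F) ^ 2 := by ring
    _ ≤ n ^ 2 * (G * F) ^ 2 := by gcongr; nlinarith
    _ = _ := by ring

/-- It is exponentially unlikely that `n - s` of `n` siblings have finished at a time `ε` before the
quantile. -/
lemma measureReal_le_card_le {s : ℕ} {D a μ α : ℝ} (hD : 0 < D) (hμ : 0 < μ)
    (hα : 0 < α) (hs : (s : ℝ) = α * n) (hsn : s ≤ n) {X : Fin n → Ω → ℝ}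
    (hX : ∀ i, IsComputationTime P a μ D (X i)) (hind : iIndepFun X P)
    {ε : ℝ} (hε : 0 ≤ ε) (hεq : a * D ≤ quantile D a μ α - ε) :
    P.real {ω | n - s ≤ (Finset.univ.filter fun i => X i ω ≤ quantile D a μ α - ε).card} ≤
      Real.exp (-(2 * n * (α * (Real.exp (μ / D * ε) - 1)) ^ 2)) := by
  have hc : 0 < μ / D := by positivity
  have hp : ∀ i, P.real {ω | X i ω ∈ Set.Iic (quantile D a μ α - ε)} =
      1 - α * Real.exp (μ / D * ε) := by
    intro i
    have := exp_quantile (a := a) hD hμ hα (-ε)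
    rw [neg_mul_neg] at this
    rw [← this, ← sub_eq_add_neg, ← (hX i).2 _ hεq]
    rfl
  have h1 : 1 ≤ Real.exp (μ / D * ε) := Real.one_le_exp (by positivity)
  have := measureReal_le_card_le_exp (fun i => (hX i).1) hind measurableSet_Iic hp
    (β := 1 - α) (by nlinarith)
  refine le_trans (measureReal_mono fun ω hω => ?_) (this.trans (le_of_eq ?_))
  · simp only [Set.mem_ofPred_eq, Set.mem_Iic] at hω ⊢
    have : ((n - s : ℕ) : ℝ) ≤ _ := Nat.cast_le.2 hω
    rw [Nat.cast_sub hsn, hs] at this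
    linarith
  · congr 1
    ring

/-! ### Tail and mean of the run-time -/

/-- Union bound over all parents of the tree: there are at most `(n + 1) ^ h` of them. -/
lemma measureReal_lt_recoverTime_le {s : ℕ} {tc x B : ℝ} (htc : 0 ≤ tc) (hx : 0 ≤ x)
    (hB0 : 0 ≤ B) {h : ℕ} (t : Worker n h → Ω → ℝ)
    (hB : ∀ u : Fin n → Worker n h, Function.Injective u →
      P.real {ω | (Finset.univ.filter fun i => t (u i) ω ≤ x).card < n - s} ≤ B) :
    P.real {ω | x + h * ((n - s : ℕ) * tc) < recoverTime n s tc h fun w => t w ω} ≤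
      (n + 1) ^ h * B := by
  induction h with
  | zero => simpa [recoverTime, hx.not_gt] using hB0
  | succ h ih =>
    have hsub : {ω | x + (h + 1 : ℕ) * ((n - s : ℕ) * tc) <
          recoverTime n s tc (h + 1) fun w => t w ω} ⊆
        {ω | (Finset.univ.filter fun i => t (Worker.child i) ω ≤ x).card < n - s} ∪
        ⋃ i, {ω | x + h * ((n - s : ℕ) * tc) <
          recoverTime n s tc h fun w => t (Worker.inside i w) ω} := by
      intro ω hω
      by_contra hcon
      simp only [Set.mem_union, Set.mem_ofPred_eq, Set.mem_iUnion, not_or, not_lt,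
        not_exists] at hcon
      exact (recoverTime_succ_le htc hx (fun w => t w ω) hcon.1 hcon.2).not_gt hω
    have hI : ∀ i, P.real {ω | x + h * ((n - s : ℕ) * tc) <
        recoverTime n s tc h fun w => t (Worker.inside i w) ω} ≤ (n + 1) ^ h * B :=
      fun i => ih (fun w => t (Worker.inside i w)) fun u hu =>
        hB (fun j => Worker.inside i (u j)) fun j j' hjj => hu (by simpa using hjj)
    calc _ ≤ _ := measureReal_mono hsub
      _ ≤ _ := measureReal_union_le _ _
      _ ≤ B + ∑ _i : Fin n, (n + 1) ^ h * B := by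
        gcongr
        · exact hB _ fun i j hij => by simpa using hij
        · exact (measureReal_iUnion_fintype_le _).trans (Finset.sum_le_sum fun i _ => hI i)
      _ ≤ (n + 1) ^ (h + 1) * B := by
        have : (1 : ℝ) ≤ (n + 1) ^ h := one_le_pow₀ (by linarith [n.cast_nonneg (α := ℝ)])
        simp only [Finset.sum_const, Finset.card_univ, Fintype.card_fin, nsmul_eq_mul]
        rw [pow_succ]
        nlinarith

lemma integrable_and_integral_le_of_exp_tail {Y : Ω → ℝ} (hY : Measurable Y) (hY0 : ∀ ω, 0 ≤ Y ω)
    {z A b : ℝ} (hA : 0 ≤ A) (hb : 0 < b)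
    (htail : ∀ y, 0 < y → P.real {ω | z + y < Y ω} ≤ A * Real.exp (-b * y)) :
    Integrable Y P ∧ ∫ ω, Y ω ∂P ≤ z + A / b := by
  set W : Ω → ℝ := fun ω => max (Y ω - z) 0 with hW
  have hWm : Measurable W := (hY.sub_const z).max measurable_const
  have hW0 : ∀ ω, 0 ≤ W ω := fun ω => le_max_right _ _
  have hint : IntegrableOn (fun y => A * Real.exp (-b * y)) (Set.Ioi 0) :=
    (integrableOn_exp_mul_Ioi (by linarith) 0).const_mul A
  have hlin : ∫⁻ ω, ENNReal.ofReal (W ω) ∂P ≤ ENNReal.ofReal (A / b) := by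
    rw [lintegral_eq_lintegral_meas_lt P (ae_of_all _ hW0) hWm.aemeasurable]
    calc _ ≤ ∫⁻ y in Set.Ioi (0 : ℝ), ENNReal.ofReal (A * Real.exp (-b * y)) := by
          refine setLIntegral_mono' measurableSet_Ioi fun y hy => ?_
          rw [← ofReal_measureReal]
          refine ENNReal.ofReal_le_ofReal ((measureReal_mono fun ω hω => ?_).trans (htail y hy))
          simp only [hW, Set.mem_ofPred_eq, lt_max_iff, Set.mem_Ioi] at hω hy ⊢
          rcases hω with h | h <;> linarith
      _ = ENNReal.ofReal (A / b) := by
          rw [← ofReal_integral_eq_lintegral_ofReal hint (ae_of_all _ fun y => by positivity),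
            integral_const_mul, integral_exp_mul_Ioi (by linarith)]
          simp [div_eq_mul_inv]
  have hWi : Integrable W P :=
    ⟨hWm.aestronglyMeasurable, by
      rw [hasFiniteIntegral_iff_ofReal (ae_of_all _ hW0)]
      exact hlin.trans_lt ENNReal.ofReal_lt_top⟩
  have hYW : ∀ ω, Y ω ≤ z + W ω := fun ω => by linarith [le_max_left (Y ω - z) 0]
  have hYi : Integrable Y P := ((integrable_const z).add hWi).mono' hY.aestronglyMeasurable
    (ae_of_all _ fun ω => by
      rw [Real.norm_of_nonneg (hY0 ω)]
      exact hYW ω)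
  refine ⟨hYi, (integral_mono hYi ((integrable_const z).add hWi) hYW).trans ?_⟩
  have hWle : ∫ ω, W ω ∂P ≤ A / b := by
    rw [integral_eq_lintegral_of_nonneg_ae (ae_of_all _ hW0) hWm.aestronglyMeasurable]
    exact ENNReal.toReal_le_of_le_ofReal (by positivity) hlin
  rw [integral_add' (integrable_const z) hWi]
  simpa using hWle

/-- Upper bound on the mean run-time at finite `n`, with a slack `ε` in the quantile. -/
lemma integrable_runTime_and_integral_le {s L : ℕ} {tc D a μ α : ℝ} (htc : 0 ≤ tc) (hD : 0 < D)
    (ha : 0 ≤ a) (hμ : 0 < μ) (hα : 0 < α) (hα1 : α < 1) (hs : (s : ℝ) = α * n)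
    {t : Worker n L → Ω → ℝ} (ht : ∀ w, IsComputationTime P a μ D (t w)) (hind : iIndepFun t P)
    {ε : ℝ} (hε : 0 < ε) :
    Integrable (fun ω => runTime n s L tc fun w => t w ω) P ∧
    ∫ ω, runTime n s L tc (fun w => t w ω) ∂P ≤
      quantile D a μ α + ε + L * ((n - s : ℕ) * tc) +
        (n + 1) ^ (L + 1) * Real.exp (-(n * (α * (1 - Real.exp (-(μ / D) * ε))) ^ 2)) /
          (μ / D / 2) := by
  have hq := quantile_sub_pos (a := a) hD hμ hα hα1
  have haD : 0 ≤ a * D := by positivity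
  refine integrable_and_integral_le_of_exp_tail
    (measurable_recoverTime s tc fun w => (ht w).1) (fun ω => recoverTime_nonneg htc _)
    (by positivity) (by positivity) fun y hy => ?_
  have := measureReal_lt_recoverTime_le (P := P) (s := s) htc
    (x := quantile D a μ α + ε + y) (by linarith) (by positivity) t fun u hu =>
    measureReal_card_lt_le hD hμ hα hα1 hs (fun i => ht (u i)) (hind.precomp hu) hε hy.le
  refine le_trans (le_of_eq ?_) (this.trans ?_)
  · congr 1
    ext ω
    simp only [Set.mem_ofPred_eq]
    constructor <;> intro h <;> linarith
  · rw [pow_succ (n + 1 : ℝ) L, ← mul_assoc, ← mul_assoc]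
    gcongr
    linarith

/-- Lower bound on the mean run-time at finite `n`, from the children of the master alone. -/
lemma quantile_sub_mul_le_integral_runTime {s L : ℕ} {tc D a μ α : ℝ} (hL : 1 ≤ L) (htc : 0 ≤ tc)
    (hD : 0 < D) (ha : 0 ≤ a) (hμ : 0 < μ) (hα : 0 < α) (hs : (s : ℝ) = α * n) (hsn : s ≤ n)
    {t : Worker n L → Ω → ℝ} (ht : ∀ w, IsComputationTime P a μ D (t w)) (hind : iIndepFun t P)
    (hint : Integrable (fun ω => runTime n s L tc fun w => t w ω) P)
    {ε : ℝ} (hε : 0 ≤ ε) (hεq : a * D ≤ quantile D a μ α - ε) :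
    (quantile D a μ α - ε) *
        (1 - Real.exp (-(2 * n * (α * (Real.exp (μ / D * ε) - 1)) ^ 2))) ≤
      ∫ ω, runTime n s L tc (fun w => t w ω) ∂P := by
  obtain ⟨h, rfl⟩ : ∃ h, L = h + 1 := ⟨L - 1, by omega⟩
  have hx : 0 ≤ quantile D a μ α - ε := le_trans (by positivity) hεq
  set x := quantile D a μ α - ε
  set R : Ω → ℝ := fun ω => runTime n s (h + 1) tc fun w => t w ω with hR
  have hRm : Measurable R := measurable_recoverTime s tc fun w => (ht w).1
  have hset : MeasurableSet {ω | R ω ≤ x} := measurableSet_le hRm measurable_const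
  have hlate : P.real {ω | R ω ≤ x} ≤
      Real.exp (-(2 * n * (α * (Real.exp (μ / D * ε) - 1)) ^ 2)) :=
    (measureReal_mono fun ω hω => le_card_of_recoverTime_le htc _ hω).trans
      (measureReal_le_card_le hD hμ hα hs hsn (fun i => ht (Worker.child i))
        (hind.precomp fun i j hij => by simpa using hij) hε hεq)
  calc _ ≤ x * P.real {ω | x ≤ R ω} := by
        gcongr
        have h1 := probReal_compl_eq_one_sub (μ := P) hset
        have h2 : P.real {ω | R ω ≤ x}ᶜ ≤ P.real {ω | x ≤ R ω} :=
          measureReal_mono fun ω hω => (not_le.1 (show ¬ R ω ≤ x from hω)).le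
        linarith
    _ ≤ _ := mul_meas_ge_le_integral_of_nonneg
        (ae_of_all _ fun ω => recoverTime_nonneg htc _) hint x

/-! ### Asymptotics of the load and of the error terms -/

lemma compTerm_eq_quantile (n s L : ℕ) (d a μ α : ℝ) :
    compTerm n s L d a μ α = quantile (load n s L * d) a μ α := by
  rw [compTerm, quantile, mul_assoc a]

lemma load_pos {n s L : ℕ} (hn : 0 < n) (hL : 1 ≤ L) : 0 < load n s L := by
  have : 0 < ∑ l ∈ Finset.Icc 1 L, ((n : ℝ) / ((s : ℝ) + 1)) ^ l :=
    Finset.sum_pos (fun _ _ => by positivity) ⟨1, by simp [hL]⟩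
  rw [load]
  positivity

lemma tendsto_load {n s : ℕ → ℕ} {α : ℝ} (hα : 0 < α) (hn : Tendsto n atTop atTop)
    (hs : ∀ k, (s k : ℝ) = α * n k) (L : ℕ) :
    Tendsto (fun k => load (n k) (s k) L) atTop
      (𝓝 (1 / ∑ l ∈ Finset.Icc 1 L, (1 / α) ^ l)) := by
  rcases Nat.eq_zero_or_pos L with rfl | hL
  · simp [load]
  have hn' : Tendsto (fun k => (n k : ℝ)) atTop atTop := tendsto_natCast_atTop_atTop.comp hn
  have hratio : Tendsto (fun k => (n k : ℝ) / (s k + 1)) atTop (𝓝 (1 / α)) := by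
    have h1 : Tendsto (fun k => 1 / (α + (n k : ℝ)⁻¹)) atTop (𝓝 (1 / (α + 0))) :=
      tendsto_const_nhds.div (tendsto_const_nhds.add (tendsto_inv_atTop_zero.comp hn'))
        (by simpa using hα.ne')
    rw [add_zero] at h1
    refine h1.congr' ?_
    filter_upwards [hn.eventually_gt_atTop 0] with k hk
    have : (0 : ℝ) < n k := by exact_mod_cast hk
    rw [hs]
    field_simp
  have hpos : 0 < ∑ l ∈ Finset.Icc 1 L, (1 / α) ^ l :=
    Finset.sum_pos (fun _ _ => by positivity) ⟨1, by simp; omega⟩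
  exact tendsto_const_nhds.div (tendsto_finsetSum _ fun l _ => hratio.pow l) hpos.ne'

lemma tendsto_pow_mul_exp_neg_mul {n : ℕ → ℕ} (hn : Tendsto n atTop atTop) {δ : ℕ → ℝ} {δ₀ : ℝ}
    (hδ₀ : 0 < δ₀) (hδ : Tendsto δ atTop (𝓝 δ₀)) (m : ℕ) :
    Tendsto (fun k => ((n k : ℝ) + 1) ^ m * Real.exp (-(n k * δ k))) atTop (𝓝 0) := by
  have hn' : Tendsto (fun k => ((n k : ℝ) + 1) * (δ₀ / 2)) atTop atTop :=
    ((tendsto_natCast_atTop_atTop.comp hn).atTop_add tendsto_const_nhds).atTop_mul_const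
      (by positivity)
  have h := ((Real.tendsto_pow_mul_exp_neg_atTop_nhds_zero m).comp hn').mul_const
    ((2 / δ₀) ^ m * Real.exp (δ₀ / 2))
  rw [zero_mul] at h
  refine squeeze_zero' (Eventually.of_forall fun k => by positivity) ?_ h
  filter_upwards [hδ.eventually_const_le (show δ₀ / 2 < δ₀ by linarith)] with k hk
  have h1 : Real.exp (-(n k * δ k)) ≤
      Real.exp (-(((n k : ℝ) + 1) * (δ₀ / 2))) * Real.exp (δ₀ / 2) := by
    rw [← Real.exp_add]
    refine Real.exp_le_exp.2 ?_
    have := mul_le_mul_of_nonneg_left hk (n k).cast_nonneg (α := ℝ)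
    linarith
  calc _ ≤ ((n k : ℝ) + 1) ^ m *
        (Real.exp (-(((n k : ℝ) + 1) * (δ₀ / 2))) * Real.exp (δ₀ / 2)) := by gcongr
    _ = ((n k : ℝ) + 1) ^ m * (δ₀ / 2 * (2 / δ₀)) ^ m *
        (Real.exp (-(((n k : ℝ) + 1) * (δ₀ / 2))) * Real.exp (δ₀ / 2)) := by
      rw [show δ₀ / 2 * (2 / δ₀) = 1 by field_simp]; simp
    _ = _ := by simp only [Function.comp_apply, mul_pow]; ring

end CodedReduce

/-! ### The expected run-time -/

theorem theorem2
    (L : ℕ) (hL : 1 ≤ L)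
    (d a μ tc α : ℝ) (hd : 0 < d) (ha : 0 ≤ a) (hμ : 0 < μ) (htc : 0 ≤ tc)
    (hα0 : 0 < α) (hα1 : α < 1)
    -- the regime: `n → ∞` with `s / n = α` constant
    (n s : ℕ → ℕ) (hn0 : ∀ k, 0 < n k) (hn : Tendsto n atTop atTop)
    (hs : ∀ k, (s k : ℝ) / (n k : ℝ) = α)
    -- independent computation times of the workers of the `(n k, L)`-regular tree
    (Ω : ℕ → Type*) [∀ k, MeasurableSpace (Ω k)]
    (P : (k : ℕ) → Measure (Ω k)) [∀ k, IsProbabilityMeasure (P k)]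
    (T : (k : ℕ) → CodedReduce.Worker (n k) L → Ω k → ℝ)
    (hT : ∀ k w, CodedReduce.IsComputationTime (P k) a μ
      (CodedReduce.load (n k) (s k) L * d) (T k w))
    (hind : ∀ k, iIndepFun (T k) (P k))
    -- the expected run-time
    (E : ℕ → ℝ)
    (hE : ∀ k, E k = ∫ ω, CodedReduce.runTime (n k) (s k) L tc (fun w => T k w ω) ∂(P k)) :
    (∀ k, Integrable
      (fun ω => CodedReduce.runTime (n k) (s k) L tc (fun w => T k w ω)) (P k)) ∧
    -- lower bound
    (∃ g h e : ℕ → ℝ, (∀ k, 0 ≤ g k) ∧ g =o[atTop] (fun k => (n k : ℝ)) ∧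
      (∀ k, 0 ≤ h k) ∧ Tendsto h atTop (𝓝 0) ∧ Tendsto e atTop (𝓝 0) ∧
      ∀ k, CodedReduce.compTerm (n k) (s k) L d a μ α
        + ((n k : ℝ) * (1 - α) - g k + (L : ℝ) - 1) * (1 - h k) * tc + e k ≤ E k) ∧
    -- upper bound
    (∃ h e : ℕ → ℝ, (∀ k, 0 ≤ h k) ∧ Tendsto h atTop (𝓝 0) ∧ Tendsto e atTop (𝓝 0) ∧
      ∀ k, E k ≤ CodedReduce.compTerm (n k) (s k) L d a μ α
        + (n k : ℝ) * (1 - h k) * (L : ℝ) * tc + e k) ∧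
    -- the expected run-time is `Θ(1) + Θ(n)`
    (fun k => CodedReduce.compTerm (n k) (s k) L d a μ α) =Θ[atTop] (fun _ => (1 : ℝ)) ∧
    (0 < tc → (fun k => E k - CodedReduce.compTerm (n k) (s k) L d a μ α)
      =Θ[atTop] (fun k => (n k : ℝ))) := by
  open CodedReduce in
  have hnpos : ∀ k, (0 : ℝ) < n k := fun k => by exact_mod_cast hn0 k
  have hs' : ∀ k, (s k : ℝ) = α * n k := fun k => (div_eq_iff (hnpos k).ne').1 (hs k)
  have hsn : ∀ k, s k < n k := fun k => by
    have : (s k : ℝ) < n k := by rw [hs']; nlinarith [hnpos k]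
    exact_mod_cast this
  have hm : ∀ k, ((n k - s k : ℕ) : ℝ) = n k * (1 - α) := fun k => by
    rw [Nat.cast_sub (hsn k).le, hs']; ring
  have hm1 : ∀ k, 1 ≤ (n k : ℝ) * (1 - α) := fun k => by
    rw [← hm]; exact_mod_cast Nat.sub_pos_of_lt (hsn k)
  have hL1 : (1 : ℝ) ≤ L := by exact_mod_cast hL
  have hn' : Tendsto (fun k => (n k : ℝ)) atTop atTop := tendsto_natCast_atTop_atTop.comp hn
  simp only [compTerm_eq_quantile]
  -- `D` is the amount of data per worker and `q` the computation term; both converge.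
  set D : ℕ → ℝ := fun k => load (n k) (s k) L * d
  set q : ℕ → ℝ := fun k => quantile (D k) a μ α
  have hD : ∀ k, 0 < D k := fun k => mul_pos (load_pos (hn0 k) hL) hd
  obtain ⟨D₀, hD₀, hDlim⟩ : ∃ D₀ : ℝ, 0 < D₀ ∧ Tendsto D atTop (𝓝 D₀) := by
    refine ⟨_, ?_, (tendsto_load hα0 hn hs' L).mul_const d⟩
    have : 0 < ∑ l ∈ Finset.Icc 1 L, (1 / α) ^ l :=
      Finset.sum_pos (fun _ _ => by positivity) ⟨1, by simp [hL]⟩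
    positivity
  have hqlim : Tendsto q atTop (𝓝 (quantile D₀ a μ α)) :=
    ((hDlim.div_const μ).mul_const _).add (hDlim.const_mul a)
  have hclim : Tendsto (fun k => μ / D k) atTop (𝓝 (μ / D₀)) :=
    tendsto_const_nhds.div hDlim hD₀.ne'
  have hc₀ : 0 < μ / D₀ := by positivity
  have hgap : ∀ k, 0 < q k - a * D k := fun k => quantile_sub_pos (hD k) hμ hα0 hα1
  have hgap₀ : 0 < quantile D₀ a μ α - a * D₀ := quantile_sub_pos hD₀ hμ hα0 hα1
  have hq0 : ∀ k, 0 ≤ q k := fun k => by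
    have := hgap k
    have := mul_nonneg ha (hD k).le
    linarith
  have hq₀ : 0 < quantile D₀ a μ α := by
    have := mul_nonneg ha hD₀.le
    linarith
  have hupper := fun k (ε : ℝ) (hε : 0 < ε) =>
    integrable_runTime_and_integral_le htc (hD k) ha hμ hα0 hα1 (hs' k) (hT k) (hind k) hε
  have hint := fun k => (hupper k 1 one_pos).1
  have hEup : ∀ ε > 0, ∀ᶠ k in atTop, E k ≤ q k + n k * L * tc + ε := by
    intro ε hε
    have hδ : Tendsto (fun k => (α * (1 - Real.exp (-(μ / D k) * (ε / 2)))) ^ 2) atTop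
        (𝓝 ((α * (1 - Real.exp (-(μ / D₀) * (ε / 2)))) ^ 2)) :=
      ((tendsto_const_nhds.sub
        ((Real.continuous_exp.tendsto _).comp (hclim.neg.mul_const _))).const_mul α).pow 2
    have hδ₀ : 0 < (α * (1 - Real.exp (-(μ / D₀) * (ε / 2)))) ^ 2 := by
      have : Real.exp (-(μ / D₀) * (ε / 2)) < 1 := by
        rw [Real.exp_lt_one_iff]
        have : 0 < μ / D₀ * (ε / 2) := by positivity
        linarith
      have : 0 < 1 - Real.exp (-(μ / D₀) * (ε / 2)) := by linarith
      positivity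
    have herr := (tendsto_pow_mul_exp_neg_mul hn hδ₀ hδ (L + 1)).div (hclim.div_const 2)
      (by positivity)
    rw [zero_div] at herr
    filter_upwards [herr.eventually_le_const (show (0 : ℝ) < ε / 2 by positivity)] with k hk
    have h1 := (hupper k (ε / 2) (by positivity)).2
    rw [← hE, hm] at h1
    change E k ≤ q k + _ + _ + _ at h1
    rw [Pi.div_apply] at hk
    have h2 : (L : ℝ) * (n k * (1 - α) * tc) ≤ n k * L * tc := by
      have : 0 ≤ (n k : ℝ) * L * tc := by positivity
      nlinarith
    linarith
  have hElow : ∀ k, (L : ℝ) * (n k * (1 - α) * tc) ≤ E k := fun k => by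
    have := integral_mono (integrable_const _) (hint k)
      fun ω => mul_le_recoverTime (hsn k) (tc := tc) fun w => T k w ω
    rw [← hE, hm] at this
    simpa using this
  have hElow' : ∀ ε > 0, ∀ᶠ k in atTop, q k - ε ≤ E k := by
    intro ε hε
    set ε' := min (ε / 2) ((quantile D₀ a μ α - a * D₀) / 2)
    have hε'0 : 0 < ε' := lt_min (by positivity) (by positivity)
    have hδ : Tendsto (fun k => 2 * (α * (Real.exp (μ / D k * ε') - 1)) ^ 2) atTop
        (𝓝 (2 * (α * (Real.exp (μ / D₀ * ε') - 1)) ^ 2)) :=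
      ((((Real.continuous_exp.tendsto _).comp (hclim.mul_const _)).sub_const 1).const_mul
        α).pow 2 |>.const_mul 2
    have hδ₀ : 0 < 2 * (α * (Real.exp (μ / D₀ * ε') - 1)) ^ 2 := by
      have : 0 < Real.exp (μ / D₀ * ε') - 1 := by
        rw [sub_pos, Real.one_lt_exp_iff]
        positivity
      positivity
    have herr := hqlim.mul (tendsto_pow_mul_exp_neg_mul hn hδ₀ hδ 0)
    rw [mul_zero] at herr
    have hε'gap : ε' < quantile D₀ a μ α - a * D₀ := (min_le_right _ _).trans_lt (by linarith)
    filter_upwards [herr.eventually_le_const (show (0 : ℝ) < ε / 2 by positivity),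
      (hqlim.sub (hDlim.const_mul a)).eventually_const_le hε'gap] with k hk hk'
    have h1 := quantile_sub_mul_le_integral_runTime hL htc (hD k) ha hμ hα0 (hs' k) (hsn k).le
      (hT k) (hind k) (hint k) hε'0.le (show a * D k ≤ q k - ε' by linarith)
    rw [← hE, show (2 : ℝ) * n k * (α * (Real.exp (μ / D k * ε') - 1)) ^ 2 =
      n k * (2 * (α * (Real.exp (μ / D k * ε') - 1)) ^ 2) by ring] at h1
    rw [pow_zero, one_mul] at hk
    have h2 : ε' ≤ ε / 2 := min_le_left _ _
    change (q k - ε') * _ ≤ _ at h1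
    have h3 := mul_nonneg hε'0.le
      (Real.exp_pos (-(n k * (2 * (α * (Real.exp (μ / D k * ε') - 1)) ^ 2)))).le
    linarith
  have hqbig : q =O[atTop] fun _ => (1 : ℝ) := hqlim.isBigO_one ℝ
  have hone : (fun _ => (1 : ℝ)) =o[atTop] fun k => (n k : ℝ) :=
    (isLittleO_const_left.2 (Or.inr (tendsto_norm_atTop_atTop.comp hn')))
  refine ⟨hint, ?_, ?_, ?_, ?_⟩
  · rcases htc.eq_or_lt with rfl | htc'
    · refine ⟨0, 0, fun k => min 0 (E k - q k), fun _ => le_rfl, isLittleO_zero _ _,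
        fun _ => le_rfl, tendsto_const_nhds, ?_, fun k => ?_⟩
      · rw [Metric.tendsto_nhds]
        intro ε hε
        filter_upwards [hElow' (ε / 2) (by positivity)] with k hk
        rw [Real.dist_eq, sub_zero, abs_of_nonpos (min_le_left _ _), neg_lt]
        exact lt_min (by linarith) (by linarith)
      · have := min_le_right 0 (E k - q k)
        simp only [mul_zero, add_zero]
        linarith
    · -- The allowed loss `o(n) tc` absorbs the bounded computation term. For `L = 1` a loss of
      -- constant order is unavoidable: the receptions overlap with the computations.
      refine ⟨fun k => q k / tc, 0, 0, fun k => div_nonneg (hq0 k) htc, ?_, fun _ => le_rfl,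
        tendsto_const_nhds, tendsto_const_nhds, fun k => ?_⟩
      · simp only [div_eq_inv_mul]
        exact (hqbig.const_mul_left _).trans_isLittleO hone
      · refine le_trans ?_ (hElow k)
        have h1 : q k / tc * tc = q k := div_mul_cancel₀ _ htc'.ne'
        have h2 := mul_nonneg (mul_nonneg (sub_nonneg.2 hL1) (sub_nonneg.2 (hm1 k))) htc
        simp only [Pi.zero_apply, sub_zero, mul_one, add_zero]
        change q k + _ ≤ _
        linarith
  · refine ⟨0, fun k => max 0 (E k - (q k + n k * L * tc)), fun _ => le_rfl, tendsto_const_nhds,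
      ?_, fun k => ?_⟩
    · rw [Metric.tendsto_nhds]
      intro ε hε
      filter_upwards [hEup (ε / 2) (by positivity)] with k hk
      rw [Real.dist_eq, sub_zero, abs_of_nonneg (le_max_left _ _)]
      exact max_lt hε (by linarith)
    · have := le_max_right 0 (E k - (q k + n k * L * tc))
      simp only [Pi.zero_apply, sub_zero, mul_one]
      change _ ≤ q k + _ + _
      linarith
  · exact ((isEquivalent_const_iff_tendsto hq₀.ne').2 hqlim).isTheta.trans
      (isTheta_const_const hq₀.ne' one_ne_zero)
  · intro htc'
    have h1α : 0 < 1 - α := by linarith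
    have hlow : ∀ k, n k * (1 - α) * tc ≤ E k := fun k => by
      have h1 := hElow k
      have h2 : 0 ≤ (n k : ℝ) * (1 - α) * tc := by positivity
      nlinarith
    -- Eventually `q ≤ n (1 - α) tc / 2`, so the communication part dominates.
    have hqsmall : ∀ᶠ k in atTop, q k ≤ (1 - α) * tc / 2 * n k := by
      filter_upwards [(hqbig.trans_isLittleO hone).bound
        (show 0 < (1 - α) * tc / 2 by positivity)] with k hk
      rwa [Real.norm_of_nonneg (hq0 k), Real.norm_of_nonneg (hnpos k).le] at hk
    refine ⟨IsBigO.of_bound (L * tc + 1) ?_, IsBigO.of_bound (2 / ((1 - α) * tc)) ?_⟩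
    · filter_upwards [hqsmall, hEup 1 one_pos] with k hk hk'
      have h1 := hlow k
      have h2 : 0 ≤ (n k : ℝ) * (1 - α) * tc := by positivity
      have h3 : (1 : ℝ) ≤ n k := by exact_mod_cast hn0 k
      change ‖E k - q k‖ ≤ _
      rw [Real.norm_of_nonneg (by linarith), Real.norm_of_nonneg (hnpos k).le]
      linarith
    · filter_upwards [hqsmall] with k hk
      have h1 := hlow k
      have h2 : 0 ≤ (n k : ℝ) * (1 - α) * tc := by positivity
      change _ ≤ _ * ‖E k - q k‖
      rw [Real.norm_of_nonneg (show 0 ≤ E k - q k by linarith),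
        Real.norm_of_nonneg (hnpos k).le, div_mul_eq_mul_div,
        le_div_iff₀ (by positivity)]
      linarith
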